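/- Let $n\ge 1$, let $v_0,\dots,v_{m-1}\in N=\mathbb Z^n$ generate $N$, let $\lambda\in\mathbb R^m$, and let $u\in M=N^\vee$ satisfy $\langle u,v_i\rangle=1$ for all $i$. Put $\Delta=\{\nu\in M_{\mathbb R}:\langle\nu,v_i\rangle\ge-\lambda_i\ \forall i\}$ and $G_{\mathbb R}=\ker(\mathbb R^m\to N_{\mathbb R},\ e_i\mapsto v_i)$, and let $$X_\Delta=\Big\{z\in\mathbb C^m:\textstyle\sum_j g_j|z_j|^2=\sum_j g_j\lambda_j\ \ \forall g\in G_{\mathbb R}\Big\}\Big/G_{\mathbb R},\qquad g\cdot z=(e^{ig_j}z_j)_j,$$ be the symplectic quotient (the toric Calabi–Yau manifold with polytope $\Delta$ when $\Delta$ is smooth). Its moment map $\mu_\Delta:X_\Delta\to\Delta\subset M_{\mathbb R}$ sends $[z]$ to the unique $\nu$ with $\langle\nu,v_j\rangle+\lambda_j=|z_j|^2$ for all $j$, and $\chi^u:X_\Delta\to\mathbb C$ is the character $\chi^u([z])=\prod_j z_j^{\langle u,v_j\rangle}$. For $\epsilon\in\mathbb C^\times$ the Gross fibration is $$\mu_G:X_\Delta\to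 M_{\mathbb R}/\mathbb Ru\times\mathbb R_{\ge0},\qquad \mu_G(x)=([\mu_\Delta(x)],|\chi^u(x)-\epsilon|^2).$$ Let $l^{(1)},\dots,l^{(k)},l_\perp^{(k+1)},\dots,l_\perp^{(m)}\in\mathbb Z^m$ be linearly independent with $l^{(a)}\cdot l_\perp^{(b)}=0$ for all $a,b$, and assume $\sum_j l^{(a)}_j=0$ for all $a$ (the condition for the Lagrangian below to be special). For real constants $c^{(a)},\phi^{(b)}$ let $\tilde L\subset\mathbb C^m$ be the set of the points $(r_je^{i\theta_j})_j$ with $r_j\ge0$, $\theta_j\in\mathbb R$, $\sum_j l_j^{(a)}r_j^2=c^{(a)}$ for $a\le k$ and $\sum_j(l_\perp^{(b)})_j\theta_j=\phi^{(b)}$ for $b>k$, and let $L\subset X_\Delta$ be the image of the part of $\tilde L$ in the above level set. Theorem. There is $\Phi\in\mathbb R$, not depending on $\epsilon$, such that $\chi^u(L)=\mathbb R_{\ge0}e^{i\Phi}$ if $L\neq\emptyset$, and for every $\epsilon\in\mathbb C^\times$ $$\mu_G(L)=\frac{\mu_\Delta(L)}{\mathbb Ru}\times\mathbb R_{\ge\xi},\qquad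 \xi=\operatorname{dist}\big(\epsilon,\mathbb R_{\ge0}e^{i\Phi}\big)^2,$$ where $\mu_\Delta(L)/\mathbb Ru$ denotes the image of $\mu_\Delta(L)$ in $M_{\mathbb R}/\mathbb Ru$. For a suitable choice of $\epsilon\in\mathbb C^\times$ one has $\xi=0$, so that $\mu_G(L)=\frac{\mu_\Delta(L)}{\mathbb Ru}\times\mathbb R_{\ge0}$. -/

import Mathlib

open scoped NNReal

noncomputable section

/-- Toric Calabi–Yau data: the ray generators `v₀, …, v_{m-1}` in the lattice `N = ℤⁿ`, the support
numbers `λ₀, …, λ_{m-1}` of the polytope `Δ = {ν ∈ M_ℝ : ⟨ν, vᵢ⟩ ≥ -λᵢ}`, and a vector `u` of the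
dual lattice `M = ℤⁿ` with `⟨u, vᵢ⟩ = 1` for all `i` (the Calabi–Yau condition). The map
`β : ℤᵐ → N`, `eᵢ ↦ vᵢ`, is onto. Smoothness of `Δ` is not needed for the definitions
below and is not imposed. -/
structure ToricCY (n m : ℕ) where
  v : Fin m → Fin n → ℤ
  lam : Fin m → ℝ
  u : Fin n → ℤ
  span_eq_top : Submodule.span ℤ (Set.range v) = ⊤
  calabiYau : ∀ i, ∑ a, u a * v i a = 1

namespace ToricCY

variable {n m : ℕ} (D : ToricCY n m)

/-- The pairing `⟨ν, vᵢ⟩` of `ν ∈ M_ℝ = ℝⁿ` with the ray generator `vᵢ`. -/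
def pair (ν : Fin n → ℝ) (i : Fin m) : ℝ := ∑ a, ν a * (D.v i a : ℝ)

/-- The polytope `Δ ⊆ M_ℝ`. -/
def polytope : Set (Fin n → ℝ) := {ν | ∀ i, -D.lam i ≤ D.pair ν i}

/-- The real extension `ℝᵐ → N_ℝ`, `eᵢ ↦ vᵢ`, of `β`. -/
def betaR : (Fin m → ℝ) →ₗ[ℝ] (Fin n → ℝ) :=
  Fintype.linearCombination ℝ (fun i a => (D.v i a : ℝ))

/-- `G_ℝ = ker (ℝᵐ → N_ℝ)`, the Lie algebra of the torus by which `ℂᵐ` is reduced. -/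
def GR : Submodule ℝ (Fin m → ℝ) := LinearMap.ker D.betaR

/-- The level set in `ℂᵐ` of the moment map `z ↦ ι^∨(|z₀|², …, |z_{m-1}|²) ∈ G_ℝ^∨` of the action
of `G_ℝ`, at the level `t = ι^∨(λ)`. -/
def levelSet : Set (Fin m → ℂ) :=
  {z | ∀ g ∈ D.GR, ∑ j, g j * ‖z j‖ ^ 2 = ∑ j, g j * D.lam j}

/-- The orbit relation of `G_ℝ`, acting by `g · z = (e^{i g₀} z₀, …, e^{i g_{m-1}} z_{m-1})`, on
the level set. -/
def orbitSetoid : Setoid D.levelSet where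
  r z w := ∃ g ∈ D.GR, ∀ j, w.1 j = Complex.exp (Complex.I * (g j : ℂ)) * z.1 j
  iseqv :=
    { refl := fun z => ⟨0, D.GR.zero_mem, fun j => by simp⟩
      symm := by
        rintro z w ⟨g, hg, h⟩
        refine ⟨-g, D.GR.neg_mem hg, fun j => ?_⟩
        rw [h j, ← mul_assoc, ← Complex.exp_add]
        simp
      trans := by
        rintro x y z ⟨g, hg, h⟩ ⟨g', hg', h'⟩
        refine ⟨g + g', D.GR.add_mem hg hg', fun j => ?_⟩
        rw [h' j, h j, ← mul_assoc, ← Complex.exp_add]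
        congr 2
        simp only [Pi.add_apply]
        push_cast
        ring }

/-- `X_Δ = ℂᵐ ⫽_t G_ℝ`, the symplectic quotient (its set of points). -/
def X : Type := Quotient D.orbitSetoid

/-- The quotient map from the level set onto `X_Δ`. -/
def proj (z : D.levelSet) : D.X := Quotient.mk D.orbitSetoid z

theorem norm_eq_of_rel {z w : D.levelSet} (h : D.orbitSetoid.r z w) (j : Fin m) :
    ‖w.1 j‖ = ‖z.1 j‖ := by
  obtain ⟨g, -, h⟩ := h
  rw [h j, norm_mul, mul_comm Complex.I, Complex.norm_exp_ofReal_mul_I, one_mul]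

theorem exists_moment (z : D.levelSet) :
    ∃ ν : Fin n → ℝ, ∀ j, D.pair ν j + D.lam j = ‖z.1 j‖ ^ 2 := by
  let f : Module.Dual ℝ (Fin m → ℝ) :=
    Fintype.linearCombination ℝ (fun j => ‖z.1 j‖ ^ 2 - D.lam j)
  have hf : f ∈ (LinearMap.ker D.betaR).dualAnnihilator := by
    rw [Submodule.mem_dualAnnihilator]
    intro g hg
    have h := z.2 g hg
    simp only [f, Fintype.linearCombination_apply, smul_eq_mul, mul_sub, Finset.sum_sub_distrib]
    rw [h, sub_self]
  rw [← LinearMap.range_dualMap_eq_dualAnnihilator_ker] at hf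
  obtain ⟨p, hp⟩ := hf
  refine ⟨fun a => p (Pi.single a 1), fun j => ?_⟩
  have h1 : f (Pi.single j 1) = ‖z.1 j‖ ^ 2 - D.lam j := by
    simp [f, Fintype.linearCombination_apply_single]
  have h2 : f (Pi.single j 1) = p (fun a => (D.v j a : ℝ)) := by
    rw [← hp]
    simp [betaR, Fintype.linearCombination_apply_single]
  have h3 : p (fun a => (D.v j a : ℝ)) = D.pair (fun a => p (Pi.single a 1)) j := by
    rw [LinearMap.pi_apply_eq_sum_univ p]
    simp only [pair, smul_eq_mul]
    refine Finset.sum_congr rfl fun a _ => ?_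
    rw [mul_comm]
    congr 2
    ext b
    simp [Pi.single_apply, eq_comm]
  rw [← h3, ← h2, h1]
  ring

theorem pair_injective {ν ν' : Fin n → ℝ} (h : ∀ j, D.pair ν j = D.pair ν' j) : ν = ν' := by
  have key : ∀ w : Fin n → ℤ, ∑ a, ν a * (w a : ℝ) = ∑ a, ν' a * (w a : ℝ) := by
    intro w
    have hw : w ∈ Submodule.span ℤ (Set.range D.v) := by
      rw [D.span_eq_top]
      trivial
    induction hw using Submodule.span_induction with
    | mem x hx =>
      obtain ⟨j, rfl⟩ := hx
      exact h j
    | zero => simp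
    | add x y _ _ hx hy =>
      simp only [Pi.add_apply, Int.cast_add, mul_add, Finset.sum_add_distrib, hx, hy]
    | smul c x _ hx =>
      have e : ∀ η : Fin n → ℝ,
          ∑ a, η a * (((c • x) a : ℤ) : ℝ) = c * ∑ a, η a * (x a : ℝ) := by
        intro η
        rw [Finset.mul_sum]
        refine Finset.sum_congr rfl fun a _ => ?_
        simp only [Pi.smul_apply, smul_eq_mul, Int.cast_mul]
        ring
      rw [e, e, hx]
  ext a
  have := key (Pi.single a 1)
  simpa [Pi.single_apply] using this

/-- The moment map `μ_Δ : X_Δ → M_ℝ`: the image of `[z]` is the unique `ν ∈ M_ℝ` with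
`⟨ν, vⱼ⟩ + λⱼ = |zⱼ|²` for all `j`. -/
def momentMap : D.X → (Fin n → ℝ) :=
  Quotient.lift (fun z => (D.exists_moment z).choose) (by
    intro z w h
    refine D.pair_injective fun j => ?_
    have h1 := (D.exists_moment z).choose_spec j
    have h2 := (D.exists_moment w).choose_spec j
    rw [D.norm_eq_of_rel h j, ← h1] at h2
    exact (add_right_cancel h2).symm)

theorem momentMap_spec (z : D.levelSet) (j : Fin m) :
    D.pair (D.momentMap (D.proj z)) j + D.lam j = ‖z.1 j‖ ^ 2 :=
  (D.exists_moment z).choose_spec j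

theorem momentMap_mem_polytope (x : D.X) : D.momentMap x ∈ D.polytope := by
  induction x using Quotient.inductionOn with
  | h z =>
    intro j
    have h := D.momentMap_spec z j
    have h0 : 0 ≤ ‖z.1 j‖ ^ 2 := by positivity
    have h1 : D.momentMap (Quotient.mk _ z) = D.momentMap (D.proj z) := rfl
    rw [h1]
    linarith

theorem char_invariant (ν : Fin n → ℤ) {z w : D.levelSet} (h : D.orbitSetoid.r z w) :
    ∏ j, z.1 j ^ (∑ a, ν a * D.v j a) = ∏ j, w.1 j ^ (∑ a, ν a * D.v j a) := by
  obtain ⟨g, hg, h⟩ := h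
  have hg0 : ∑ j, (g j : ℂ) * ((∑ a, ν a * D.v j a : ℤ) : ℂ) = 0 := by
    have h0 : D.betaR g = 0 := hg
    have h1 : ∀ a, ∑ j, g j * (D.v j a : ℝ) = 0 := by
      intro a
      have := congrFun h0 a
      simpa [betaR, Fintype.linearCombination_apply] using this
    have h2 : ∑ j, g j * ((∑ a, ν a * D.v j a : ℤ) : ℝ) = 0 := by
      have : ∀ j, g j * ((∑ a, ν a * D.v j a : ℤ) : ℝ)
          = ∑ a, (ν a : ℝ) * (g j * (D.v j a : ℝ)) := by
        intro j
        push_cast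
        rw [Finset.mul_sum]
        exact Finset.sum_congr rfl fun a _ => by ring
      simp only [this]
      rw [Finset.sum_comm]
      simp only [← Finset.mul_sum, h1, mul_zero, Finset.sum_const_zero]
    exact_mod_cast congrArg (fun x : ℝ => (x : ℂ)) h2
  simp only [h, mul_zpow, Finset.prod_mul_distrib]
  have h3 : ∏ j, Complex.exp (Complex.I * (g j : ℂ)) ^ (∑ a, ν a * D.v j a) = 1 := by
    simp only [← Complex.exp_int_mul]
    rw [← Complex.exp_sum]
    have : ∑ j, ((∑ a, ν a * D.v j a : ℤ) : ℂ) * (Complex.I * (g j : ℂ))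
        = Complex.I * ∑ j, (g j : ℂ) * ((∑ a, ν a * D.v j a : ℤ) : ℂ) := by
      rw [Finset.mul_sum]
      exact Finset.sum_congr rfl fun j _ => by ring
    rw [this, hg0, mul_zero, Complex.exp_zero]
  rw [h3, one_mul]

/-- The character `χ^ν` of `ν ∈ M` in homogeneous coordinates: `χ^ν([z]) = ∏ⱼ zⱼ^{⟨ν, vⱼ⟩}`, the
pullback of `χ^ν` along `Spec ℂ[ℤᵐ] → Spec ℂ[M]`. It is a regular function on `X_Δ` when
`⟨ν, vⱼ⟩ ≥ 0` for all `j` (in particular for `ν = u`). -/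
def char (ν : Fin n → ℤ) : D.X → ℂ :=
  Quotient.lift (fun z => ∏ j, z.1 j ^ (∑ a, ν a * D.v j a)) fun _ _ h => D.char_invariant ν h

/-- The line `ℝu ⊆ M_ℝ`. -/
def lineU : Submodule ℝ (Fin n → ℝ) := Submodule.span ℝ {fun a => (D.u a : ℝ)}

/-- The Gross fibration `μ_G = ([μ_Δ], |χ^u - ε|²) : X_Δ → B = M_ℝ / ℝu × ℝ_{≥0}`. -/
def gross (ε : ℂ) (x : D.X) : ((Fin n → ℝ) ⧸ D.lineU) × ℝ≥0 :=
  (D.lineU.mkQ (D.momentMap x), ‖D.char D.u x - ε‖₊ ^ 2)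

end ToricCY

/-- The data defining a Lagrangian: integral charges `l⁽¹⁾, …, l⁽ᵏ⁾` and
`l_⊥⁽ᵏ⁺¹⁾, …, l_⊥⁽ᵐ⁾` in `ℤᵐ`, linearly independent, each `l⁽ᵃ⁾` orthogonal to each `l_⊥⁽ᵇ⁾`,
and real constants `c⁽ᵃ⁾`, `φ⁽ᵇ⁾`. Here `k' = m - k` is the number of the `l_⊥⁽ᵇ⁾`. -/
structure Charges (m k k' : ℕ) where
  card_add : k + k' = m
  l : Fin k → Fin m → ℤ
  lperp : Fin k' → Fin m → ℤ
  linearIndependent : LinearIndependent ℤ (Sum.elim l lperp)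
  orthogonal : ∀ a b, ∑ j, l a j * lperp b j = 0
  c : Fin k → ℝ
  phi : Fin k' → ℝ

namespace Charges

variable {m k k' : ℕ} (C : Charges m k k')

/-- The Lagrangian `L̃ ⊆ ℂᵐ`: the points `(r₀ e^{iθ₀}, …, r_{m-1} e^{iθ_{m-1}})` with `rⱼ ≥ 0`,
`θⱼ ∈ ℝ`, `∑ⱼ l⁽ᵃ⁾ⱼ rⱼ² = c⁽ᵃ⁾` for all `a` and `∑ⱼ (l_⊥⁽ᵇ⁾)ⱼ θⱼ = φ⁽ᵇ⁾` for all `b`. -/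
def Ltilde : Set (Fin m → ℂ) :=
  {z | ∃ r θ : Fin m → ℝ, (∀ j, 0 ≤ r j) ∧
    (∀ j, z j = (r j : ℂ) * Complex.exp (Complex.I * (θ j : ℂ))) ∧
    (∀ a, ∑ j, (C.l a j : ℝ) * r j ^ 2 = C.c a) ∧
    (∀ b, ∑ j, (C.lperp b j : ℝ) * θ j = C.phi b)}

/-- The condition `l⁽ᵃ⁾ · (1, …, 1) = 0` for all `a`, under which the Lagrangian is special. -/
def IsSpecial : Prop := ∀ a, ∑ j, C.l a j = 0

/-- The Lagrangian `L = (μ⁻¹(t) ∩ L̃) / G_ℝ ⊆ X_Δ`: the image of `μ⁻¹(t) ∩ L̃` in `X_Δ`. -/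
def L {n : ℕ} (D : ToricCY n m) : Set D.X := D.proj '' {z | z.1 ∈ C.Ltilde}

end Charges

/-- The closed half-line `ℝ_{≥0} e^{iΦ}` in `ℂ`. -/
def ray (Φ : ℝ) : Set ℂ := {w | ∃ s : ℝ, 0 ≤ s ∧ w = (s : ℂ) * Complex.exp (Complex.I * (Φ : ℂ))}

/-- The squared distance from `ε` to the half-line `ℝ_{≥0} e^{iΦ}`. -/
def sqDistRay (ε : ℂ) (Φ : ℝ) : ℝ := Metric.infDist ε (ray Φ) ^ 2

end

/-! Since `⟨u, vⱼ⟩ = 1`, the character `χ^u` is the product of the coordinates. Speciality says that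
`(1, …, 1)` is orthogonal to every `l⁽ᵃ⁾`, hence a rational combination of the `l_⊥⁽ᵇ⁾`; so the
phase equations fix `∑ θⱼ = Φ`, and `χ^u` maps `L` into the ray.

Conversely, keep the phases of a point of `L` and add a common `t` to all `rⱼ²`. The level set is
preserved because `∑ gⱼ = 0` on `G_ℝ`, the charge equations because `∑ l⁽ᵃ⁾ⱼ = 0`, and `μ_Δ` moves
by `t u`, which dies modulo `ℝu`. By the intermediate value theorem `∏ √(rⱼ² + t)` takes every value
in `[0, ∞)`. So the whole ray is attained over each class in `μ_Δ(L) / ℝu`, which makes the image a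
product; its second factor is the set of squared distances from `ε` to points of the ray. -/

/-- A nonzero multiple of a vector orthogonal to every `l⁽ᵃ⁾` is a combination of the `l_⊥⁽ᵇ⁾`. -/
theorem Charges.exists_smul_eq_sum_lperp {m k k' : ℕ} (C : Charges m k k') (w : Fin m → ℤ)
    (hw : ∀ a, ∑ j, C.l a j * w j = 0) :
    ∃ (d : ℤ) (q : Fin k' → ℤ), d ≠ 0 ∧ ∀ j, d * w j = ∑ b, q b * C.lperp b j := by
  let f : Option (Fin k ⊕ Fin k') → Fin m → ℤ := fun o => o.elim w (Sum.elim C.l C.lperp)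
  -- These are `k + k' + 1 = m + 1` vectors in `ℤᵐ`.
  have hf : ¬ LinearIndependent ℤ f := by
    intro h
    have h1 := h.fintype_card_le_finrank
    simp only [Fintype.card_option, Fintype.card_sum, Fintype.card_fin, Module.finrank_fintype_fun_eq_card] at h1
    have := C.card_add
    omega
  obtain ⟨g, hg, i, hi⟩ := Fintype.not_linearIndependent_iff.1 hf
  have hcoord : ∀ j, g none * w j + (∑ a, g (some (Sum.inl a)) * C.l a j +
      ∑ b, g (some (Sum.inr b)) * C.lperp b j) = 0 := by
    intro j
    have := congrFun hg j
    simpa [f, Fintype.sum_option, Fintype.sum_sum_type] using this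
  have hd : g none ≠ 0 := by
    intro h0
    have hli := Fintype.linearIndependent_iff.1 C.linearIndependent (fun s => g (some s)) (by
      ext j
      have := hcoord j
      rw [h0, zero_mul, zero_add] at this
      simpa [Fintype.sum_sum_type] using this)
    cases i with
    | none => exact hi h0
    | some s => exact hi (hli s)
  -- The `l`-part `y` of the relation is a combination of the `l⁽ᵃ⁾`; by the relation it is also one
  -- of `w` and the `l_⊥⁽ᵇ⁾`, hence orthogonal to all `l⁽ᵃ⁾`. So `y · y = 0` and `y = 0`.
  let y : Fin m → ℤ := fun j => ∑ a, g (some (Sum.inl a)) * C.l a j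
  have hperp : ∀ x : Fin m → ℤ, (∀ a, ∑ j, C.l a j * x j = 0) → ∑ j, y j * x j = 0 := by
    intro x hx
    simp only [y, Finset.sum_mul, mul_assoc]
    rw [Finset.sum_comm]
    simp only [← Finset.mul_sum, hx, mul_zero, Finset.sum_const_zero]
  have hyy : ∑ j, y j * y j = 0 := by
    have hy : ∀ j, y j = -(g none * w j) - ∑ b, g (some (Sum.inr b)) * C.lperp b j := by
      intro j
      have := hcoord j
      simp only [y]
      linarith
    apply hperp
    intro a
    simp only [hy, mul_sub, Finset.sum_sub_distrib, mul_neg, Finset.sum_neg_distrib, Finset.mul_sum]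
    rw [Finset.sum_comm]
    simp only [mul_left_comm (C.l a _), ← Finset.mul_sum, hw, C.orthogonal, mul_zero,
      Finset.sum_const_zero, neg_zero, sub_zero]
  have hy0 : ∀ j, y j = 0 := fun j => mul_self_eq_zero.1
    ((Finset.sum_eq_zero_iff_of_nonneg fun i _ => mul_self_nonneg (y i)).1 hyy j
      (Finset.mem_univ j))
  refine ⟨g none, fun b => -g (some (Sum.inr b)), hd, fun j => ?_⟩
  have h1 := hcoord j
  have h2 : ∑ a, g (some (Sum.inl a)) * C.l a j = 0 := hy0 j
  simp only [neg_mul, Finset.sum_neg_distrib]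
  linarith

/-- For special charges the total phase is constant on the solutions of the phase equations. -/
theorem Charges.IsSpecial.exists_phase {m k k' : ℕ} {C : Charges m k k'} (hC : C.IsSpecial) :
    ∃ Φ : ℝ, ∀ θ : Fin m → ℝ, (∀ b, ∑ j, (C.lperp b j : ℝ) * θ j = C.phi b) → ∑ j, θ j = Φ := by
  obtain ⟨d, q, hd, hq⟩ := C.exists_smul_eq_sum_lperp (fun _ => 1) (fun a => by simpa using hC a)
  refine ⟨(∑ b, (q b : ℝ) * C.phi b) / d, fun θ hθ => ?_⟩
  have hd' : (d : ℝ) ≠ 0 := by exact_mod_cast hd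
  rw [eq_div_iff hd', mul_comm, Finset.mul_sum]
  simp only [← hθ, Finset.mul_sum]
  rw [Finset.sum_comm]
  refine Finset.sum_congr rfl fun j _ => ?_
  have : (d : ℝ) = ∑ b, (q b : ℝ) * C.lperp b j := by
    have := hq j
    rw [mul_one] at this
    exact_mod_cast this
  rw [this, Finset.sum_mul]
  exact Finset.sum_congr rfl fun b _ => mul_assoc _ _ _

/-- A common shift of the squares of finitely many radii gives their product any value `s ≥ 0`. -/
theorem exists_shift_prod_sqrt_eq {ι : Type*} [Fintype ι] [Nonempty ι] (r : ι → ℝ) {s : ℝ}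
    (hs : 0 ≤ s) : ∃ t : ℝ, (∀ j, 0 ≤ r j ^ 2 + t) ∧ ∏ j, √(r j ^ 2 + t) = s := by
  -- The least admissible shift is `-min rⱼ²`, where a factor vanishes. At `(s + 1)²` every factor
  -- is at least `s + 1 ≥ 1`, so the nonempty product exceeds `s`.
  obtain ⟨j₀, hj₀⟩ := Finite.exists_min fun j => r j ^ 2
  have hle : -(r j₀ ^ 2) ≤ (s + 1) ^ 2 := by nlinarith [sq_nonneg (r j₀), sq_nonneg (s + 1)]
  have hcont : Continuous fun t : ℝ => ∏ j, √(r j ^ 2 + t) := by fun_prop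
  have hlow : ∏ j, √(r j ^ 2 + -(r j₀ ^ 2)) = 0 :=
    Finset.prod_eq_zero (Finset.mem_univ j₀) (by simp)
  have hhigh : s ≤ ∏ j, √(r j ^ 2 + (s + 1) ^ 2) := by
    have h1 : ∀ j, s + 1 ≤ √(r j ^ 2 + (s + 1) ^ 2) := fun j =>
      Real.le_sqrt_of_sq_le (by nlinarith [sq_nonneg (r j)])
    calc s ≤ s + 1 := by linarith
      _ ≤ (s + 1) ^ Fintype.card ι := le_self_pow₀ (by linarith) Fintype.card_ne_zero
      _ = ∏ _j : ι, (s + 1) := by simp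
      _ ≤ _ := Finset.prod_le_prod (fun _ _ => by linarith) fun j _ => h1 j
  obtain ⟨t, ht, hts⟩ := intermediate_value_Icc hle hcont.continuousOn
    (show s ∈ Set.Icc _ _ from ⟨by rw [hlow]; exact hs, hhigh⟩)
  exact ⟨t, fun j => by linarith [hj₀ j, ht.1], hts⟩

/-! ### Half-lines and distances to them -/

theorem mem_ray_self (Φ : ℝ) : Complex.exp (Complex.I * (Φ : ℂ)) ∈ ray Φ :=
  ⟨1, zero_le_one, by simp⟩

theorem norm_exp_I_mul (Φ : ℝ) : ‖Complex.exp (Complex.I * (Φ : ℂ))‖ = 1 := by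
  rw [mul_comm, Complex.norm_exp_ofReal_mul_I]

theorem ray_eq_image (Φ : ℝ) :
    ray Φ = (fun s : ℝ => (s : ℂ) * Complex.exp (Complex.I * (Φ : ℂ))) '' Set.Ici 0 := by
  ext w
  simp only [ray, Set.mem_ofPred_eq, Set.mem_image, Set.mem_Ici, eq_comm]

theorem isClosed_ray (Φ : ℝ) : IsClosed (ray Φ) := by
  rw [ray_eq_image]
  refine (Isometry.isClosedEmbedding ?_).isClosedMap _ isClosed_Ici
  refine Isometry.of_dist_eq fun x y => ?_
  rw [dist_eq_norm, ← sub_mul, norm_mul, norm_exp_I_mul, mul_one, ← Complex.ofReal_sub,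
    Complex.norm_real, dist_eq_norm]

/-- The squared distances from `ε` to the points of a closed half-line are all numbers from the
squared distance to the half-line on. -/
theorem image_nnnorm_sub_sq_ray (ε : ℂ) (Φ : ℝ) :
    (fun w => ‖w - ε‖₊ ^ 2) '' ray Φ = {q : ℝ≥0 | sqDistRay ε Φ ≤ (q : ℝ)} := by
  have hne : (ray Φ).Nonempty := ⟨_, mem_ray_self Φ⟩
  ext q
  constructor
  · rintro ⟨w, hw, rfl⟩
    have h := Metric.infDist_le_dist_of_mem (x := ε) hw
    rw [dist_comm, dist_eq_norm] at h
    simpa [sqDistRay] using pow_le_pow_left₀ Metric.infDist_nonneg h 2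
  · intro hq
    obtain ⟨w₀, hw₀, hdist⟩ := (isClosed_ray Φ).exists_infDist_eq_dist hne ε
    obtain ⟨s₀, hs₀, hw₀⟩ := hw₀
    let e := Complex.exp (Complex.I * (Φ : ℂ))
    let f : ℝ → ℝ := fun s => ‖(s : ℂ) * e - ε‖ ^ 2
    have hf : Continuous f := by fun_prop
    -- Chosen so that `s₁ - ‖ε‖ ≥ √q`; the reverse triangle inequality then gives `q ≤ f s₁`.
    let s₁ : ℝ := s₀ + ‖ε‖ + √q
    have hle : s₀ ≤ s₁ := by
      have := norm_nonneg ε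
      have := Real.sqrt_nonneg (q : ℝ)
      simp only [s₁]
      linarith
    have hlow : f s₀ ≤ q := by
      have : f s₀ = sqDistRay ε Φ := by
        rw [sqDistRay, hdist, hw₀, dist_comm, dist_eq_norm]
      rw [this]
      exact hq
    have hhigh : (q : ℝ) ≤ f s₁ := by
      have h1 : ‖(s₁ : ℂ) * e‖ = s₁ := by
        rw [norm_mul, norm_exp_I_mul, mul_one, Complex.norm_real, Real.norm_of_nonneg]
        linarith
      have h2 := norm_sub_norm_le ((s₁ : ℂ) * e) ε
      rw [h1] at h2
      have h3 : √(q : ℝ) ≤ ‖(s₁ : ℂ) * e - ε‖ := by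
        simp only [s₁] at h2 ⊢
        linarith
      calc (q : ℝ) = √(q : ℝ) ^ 2 := (Real.sq_sqrt q.2).symm
        _ ≤ _ := pow_le_pow_left₀ (Real.sqrt_nonneg _) h3 2
    obtain ⟨s, hs, hsq⟩ := intermediate_value_Icc hle hf.continuousOn
      (show (q : ℝ) ∈ Set.Icc _ _ from ⟨hlow, hhigh⟩)
    refine ⟨s * e, ⟨s, hs₀.trans hs.1, rfl⟩, NNReal.coe_injective ?_⟩
    simpa [f] using hsq

/-! ### Consequences of the Calabi–Yau condition -/

namespace ToricCY

variable {n m : ℕ} (D : ToricCY n m)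

/-- No vectors cannot generate `ℤⁿ` for `n ≥ 1`. An empty product would be constantly `1` and could
not sweep out the ray. -/
theorem nonempty_index (D : ToricCY n m) (hn : 1 ≤ n) : Nonempty (Fin m) := by
  by_contra h
  rw [not_nonempty_iff] at h
  have hspan := D.span_eq_top
  rw [Set.range_eq_empty, Submodule.span_empty] at hspan
  have h1 : (Pi.single ⟨0, hn⟩ 1 : Fin n → ℤ) ∈ (⊥ : Submodule ℤ (Fin n → ℤ)) := by
    rw [hspan]
    trivial
  have := congrFun ((Submodule.mem_bot ℤ).1 h1) ⟨0, hn⟩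
  simp at this

/-- Pair the relation `∑ gⱼ vⱼ = 0` with `u`. -/
theorem sum_eq_zero_of_mem_GR {g : Fin m → ℝ} (hg : g ∈ D.GR) : ∑ j, g j = 0 := by
  have h1 : ∀ a, ∑ j, g j * (D.v j a : ℝ) = 0 := fun a => by
    simpa [betaR, Fintype.linearCombination_apply] using congrFun (show D.betaR g = 0 from hg) a
  calc ∑ j, g j = ∑ j, g j * ((∑ a, D.u a * D.v j a : ℤ) : ℝ) := by simp [D.calabiYau]
    _ = ∑ a, (D.u a : ℝ) * ∑ j, g j * (D.v j a : ℝ) := by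
      push_cast
      simp only [Finset.mul_sum]
      rw [Finset.sum_comm]
      exact Finset.sum_congr rfl fun a _ => Finset.sum_congr rfl fun j _ => by ring
    _ = 0 := by simp [h1]

theorem char_u_proj (z : D.levelSet) : D.char D.u (D.proj z) = ∏ j, z.1 j := by
  change ∏ j, z.1 j ^ (∑ a, D.u a * D.v j a) = _
  simp [D.calabiYau]

theorem pair_add_smul_u (ν : Fin n → ℝ) (t : ℝ) (j : Fin m) :
    D.pair (ν + t • fun a => (D.u a : ℝ)) j = D.pair ν j + t := by
  have h : ∑ a, (D.u a : ℝ) * (D.v j a : ℝ) = 1 := by exact_mod_cast D.calabiYau j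
  simp only [pair, Pi.add_apply, Pi.smul_apply, smul_eq_mul, add_mul, Finset.sum_add_distrib,
    mul_assoc, ← Finset.mul_sum, h, mul_one]

theorem momentMap_eq_add_smul_u {z w : D.levelSet} {t : ℝ}
    (h : ∀ j, ‖w.1 j‖ ^ 2 = ‖z.1 j‖ ^ 2 + t) :
    D.momentMap (D.proj w) = D.momentMap (D.proj z) + t • fun a => (D.u a : ℝ) := by
  refine D.pair_injective fun j => ?_
  rw [pair_add_smul_u]
  linarith [D.momentMap_spec z j, D.momentMap_spec w j, h j]

end ToricCY

/-! ### The character on the Lagrangian -/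

theorem norm_ofReal_mul_exp {r : ℝ} (hr : 0 ≤ r) (θ : ℝ) :
    ‖(r : ℂ) * Complex.exp (Complex.I * (θ : ℂ))‖ = r := by
  rw [norm_mul, norm_exp_I_mul, mul_one, Complex.norm_real, Real.norm_of_nonneg hr]

theorem prod_ofReal_mul_exp {ι : Type*} [Fintype ι] (r θ : ι → ℝ) :
    ∏ j, (r j : ℂ) * Complex.exp (Complex.I * (θ j : ℂ)) =
      ((∏ j, r j : ℝ) : ℂ) * Complex.exp (Complex.I * ((∑ j, θ j : ℝ) : ℂ)) := by
  rw [Finset.prod_mul_distrib, ← Complex.exp_sum, ← Finset.mul_sum]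
  push_cast
  rfl

namespace Charges

variable {n m k k' : ℕ} {C : Charges m k k'}

theorem char_u_mem_ray (D : ToricCY n m) {Φ : ℝ}
    (hΦ : ∀ θ : Fin m → ℝ, (∀ b, ∑ j, (C.lperp b j : ℝ) * θ j = C.phi b) → ∑ j, θ j = Φ)
    {x : D.X} (hx : x ∈ C.L D) : D.char D.u x ∈ ray Φ := by
  obtain ⟨z, ⟨r, θ, hr, hz, -, hθ⟩, rfl⟩ := hx
  refine ⟨∏ j, r j, Finset.prod_nonneg fun j _ => hr j, ?_⟩
  rw [D.char_u_proj, Finset.prod_congr rfl fun j _ => hz j, prod_ofReal_mul_exp, hΦ θ hθ]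

/-- A special Lagrangian is swept out by translates in the direction `u`, along each of which
`χ^u` takes every value on the ray. -/
theorem IsSpecial.exists_mem_L_char_eq (hn : 1 ≤ n) (D : ToricCY n m) (hC : C.IsSpecial) {Φ : ℝ}
    (hΦ : ∀ θ : Fin m → ℝ, (∀ b, ∑ j, (C.lperp b j : ℝ) * θ j = C.phi b) → ∑ j, θ j = Φ)
    {x : D.X} (hx : x ∈ C.L D) {w : ℂ} (hw : w ∈ ray Φ) :
    ∃ y ∈ C.L D, D.lineU.mkQ (D.momentMap y) = D.lineU.mkQ (D.momentMap x) ∧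
      D.char D.u y = w := by
  have := D.nonempty_index hn
  obtain ⟨z, ⟨r, θ, hr, hz, hc, hθ⟩, rfl⟩ := hx
  obtain ⟨s, hs, rfl⟩ := hw
  obtain ⟨t, ht, hprod⟩ := exists_shift_prod_sqrt_eq r hs
  let r' : Fin m → ℝ := fun j => √(r j ^ 2 + t)
  have hr' : ∀ j, 0 ≤ r' j := fun j => Real.sqrt_nonneg _
  have hsq : ∀ j, r' j ^ 2 = r j ^ 2 + t := fun j => Real.sq_sqrt (ht j)
  let y : Fin m → ℂ := fun j => (r' j : ℂ) * Complex.exp (Complex.I * (θ j : ℂ))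
  have hnorm : ∀ j, ‖y j‖ ^ 2 = ‖z.1 j‖ ^ 2 + t := fun j => by
    rw [norm_ofReal_mul_exp (hr' j), hsq, hz j, norm_ofReal_mul_exp (hr j)]
  have hy : y ∈ D.levelSet := by
    intro g hg
    simp only [hnorm, mul_add, Finset.sum_add_distrib, ← Finset.sum_mul,
      D.sum_eq_zero_of_mem_GR hg, zero_mul, add_zero]
    exact z.2 g hg
  refine ⟨D.proj ⟨y, hy⟩, ⟨⟨y, hy⟩, ⟨r', θ, hr', fun _ => rfl, fun a => ?_, hθ⟩, rfl⟩, ?_, ?_⟩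
  · have h0 : ∑ j, (C.l a j : ℝ) = 0 := by exact_mod_cast hC a
    simp only [hsq, mul_add, Finset.sum_add_distrib, ← Finset.sum_mul, h0, zero_mul, add_zero]
    exact hc a
  · rw [D.momentMap_eq_add_smul_u (z := z) hnorm, map_add, add_eq_left, Submodule.mkQ_apply,
      Submodule.Quotient.mk_eq_zero]
    exact Submodule.smul_mem _ _ (Submodule.subset_span rfl)
  · rw [D.char_u_proj]
    change ∏ j, (r' j : ℂ) * Complex.exp (Complex.I * (θ j : ℂ)) = _
    rw [prod_ofReal_mul_exp, hΦ θ hθ, hprod]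

end Charges

theorem mainTheorem8 {n m k k' : ℕ} (hn : 1 ≤ n) (D : ToricCY n m) (C : Charges m k k')
    (hC : C.IsSpecial) :
    ∃ Φ : ℝ,
      ((C.L D).Nonempty → D.char D.u '' C.L D = ray Φ) ∧
      (∀ ε : ℂ, ε ≠ 0 →
        D.gross ε '' C.L D =
          (D.lineU.mkQ '' (D.momentMap '' C.L D)) ×ˢ {q : ℝ≥0 | sqDistRay ε Φ ≤ (q : ℝ)}) ∧
      ∃ ε : ℂ, ε ≠ 0 ∧ sqDistRay ε Φ = 0 ∧
        D.gross ε '' C.L D = (D.lineU.mkQ '' (D.momentMap '' C.L D)) ×ˢ Set.univ := by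
  obtain ⟨Φ, hΦ⟩ := hC.exists_phase
  have hgross : ∀ ε : ℂ, D.gross ε '' C.L D =
      (D.lineU.mkQ '' (D.momentMap '' C.L D)) ×ˢ {q : ℝ≥0 | sqDistRay ε Φ ≤ (q : ℝ)} := by
    intro ε
    rw [← image_nnnorm_sub_sq_ray]
    ext ⟨p, q⟩
    constructor
    · rintro ⟨x, hx, hpq⟩
      obtain ⟨rfl, rfl⟩ := Prod.mk.inj hpq
      exact ⟨⟨_, ⟨x, hx, rfl⟩, rfl⟩, ⟨_, Charges.char_u_mem_ray D hΦ hx, rfl⟩⟩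
    · rintro ⟨⟨_, ⟨x, hx, rfl⟩, hp⟩, ⟨w, hw, hq⟩⟩
      -- One point `y` realizes both prescribed coordinates.
      obtain ⟨y, hy, hyx, hyw⟩ := hC.exists_mem_L_char_eq hn D hΦ hx hw
      refine ⟨y, hy, Prod.ext (hyx.trans hp) ?_⟩
      rw [← hyw] at hq
      exact hq
  have hzero : sqDistRay (Complex.exp (Complex.I * (Φ : ℂ))) Φ = 0 := by
    rw [sqDistRay, Metric.infDist_zero_of_mem (mem_ray_self Φ), zero_pow two_ne_zero]
  -- The suitable `ε` is `e^{iΦ}`, a nonzero point of the ray.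
  refine ⟨Φ, fun hne => ?_, fun ε _ => hgross ε, _, Complex.exp_ne_zero _, hzero, ?_⟩
  · refine Set.Subset.antisymm ?_ fun w hw => ?_
    · rintro _ ⟨x, hx, rfl⟩
      exact Charges.char_u_mem_ray D hΦ hx
    · obtain ⟨x, hx⟩ := hne
      obtain ⟨y, hy, -, hyw⟩ := hC.exists_mem_L_char_eq hn D hΦ hx hw
      exact ⟨y, hy, hyw⟩
  · rw [hgross, hzero]
    congr 1
    exact Set.eq_univ_of_forall fun q => q.2
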